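/- Let $\mathbb K$ be $\mathbb R$ or $\mathbb C$ and let $n\ge 0$. A formal vector field is an $n$-tuple of formal power series in $\mathbb K[[x_1,\dots,x_n]]$; the Lie bracket of two formal vector fields is $[u,v]:=Dv\cdot u-Du\cdot v$, where $Du$, $Dv$ are the matrices of formal partial derivatives. Let $f$ be a formal vector field with $f(0)=0$, let $A=Df(0)$, and let $\lambda_1,\dots,\lambda_n\in\mathbb C$ be the eigenvalues of $A$, counted with algebraic multiplicity. Suppose that there are no nonnegative integers $m_1,\dots,m_n$ with $\sum_i m_i\ge 2$ and no $j\in\{1,\dots,n\}$ such that $\sum_i m_i\lambda_i-\lambda_j=0$. If $g$ is a formal vector field such that $[g,f]=\alpha f$ for some $\alpha\in\mathbb K[[x_1,\dots,x_n]]$, then there are $\beta\in\mathbb K[[x_1,\dots,x_n]]$ and a formal vector field $h$ with $[h,f]=0$ such that $g=h+\beta f$. -/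

import Mathlib

namespace FormalNF

/-- Formal power series `𝕂[[x₁, …, xₙ]]`. -/
abbrev FSeries (𝕂 : Type*) (n : ℕ) : Type _ := MvPowerSeries (Fin n) 𝕂

/-- Formal vector fields: `n`-tuples of formal power series in `n` variables, a module over the
formal power series. -/
abbrev FVectorField (𝕂 : Type*) (n : ℕ) : Type _ := Fin n → FSeries 𝕂 n

/-- The Lie bracket `[f, g] = Dg · f - Df · g`. -/
noncomputable def lieBracket {𝕂 : Type*} [Field 𝕂] {n : ℕ} (f g : FVectorField 𝕂 n) :
    FVectorField 𝕂 n :=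
  fun i => ∑ j, MvPowerSeries.pderiv 𝕂 j (g i) * f j - ∑ j, MvPowerSeries.pderiv 𝕂 j (f i) * g j

/-- The Jacobian matrix `Df(0)`, with entries `(∂fᵢ/∂xⱼ)(0)`. -/
noncomputable def jacobianAtZero {𝕂 : Type*} [Field 𝕂] {n : ℕ} (f : FVectorField 𝕂 n) :
    Matrix (Fin n) (Fin n) 𝕂 :=
  Matrix.of fun i j => MvPowerSeries.constantCoeff (MvPowerSeries.pderiv 𝕂 j (f i))

/-- The embedding of `𝕂` (that is, `ℝ` or `ℂ`) into `ℂ`. -/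
noncomputable def toComplexHom (𝕂 : Type*) [RCLike 𝕂] : 𝕂 →+* ℂ where
  toFun x := ⟨RCLike.re x, RCLike.im x⟩
  map_one' := by apply Complex.ext <;> simp
  map_zero' := by apply Complex.ext <;> simp
  map_add' x y := by apply Complex.ext <;> simp
  map_mul' x y := by apply Complex.ext <;> simp [RCLike.mul_re, RCLike.mul_im]

/-- `lam 0, …, lam (n-1)` are the complex eigenvalues of `A`, listed with algebraic
multiplicity. -/
def IsEigenvalueList {𝕂 : Type*} [RCLike 𝕂] {n : ℕ} (A : Matrix (Fin n) (Fin n) 𝕂)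
    (lam : Fin n → ℂ) : Prop :=
  (A.map (toComplexHom 𝕂)).charpoly.roots = Finset.univ.val.map lam

/-- No resonance `∑ mᵢ λᵢ - λⱼ = 0` with nonnegative integers `mᵢ` and `∑ mᵢ ≥ 2`. -/
def NonResonant {n : ℕ} (lam : Fin n → ℂ) : Prop :=
  ∀ (m : Fin n → ℕ) (j : Fin n), 2 ≤ ∑ i, m i → (∑ i, (m i : ℂ) * lam i) - lam j ≠ 0

end FormalNF

/-!
Write `L_f β = Dβ · f`. Since `[g - β f, f] = [g, f] + L_f(β) f`, it suffices to solve
`L_f β = -α`.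

* `α(0) = 0`: let `A = Df(0)`, which is invertible by nonresonance. The constant terms of
  `[g, f] = α f` give `A g(0) = 0`, so `g(0) = 0`; the linear terms then give
  `A B - B A = α(0) A` with `B = Dg(0)`. Multiplying by `A⁻¹` and taking the trace, `n α(0) = 0`.
* `L_f` maps onto the series without constant term: it preserves the order filtration, and on the
  forms of degree `k` its leading part is the derivation along `x ↦ A x`. By the Leibniz rule the
  eigenvalues of this derivation are sums of `k` eigenvalues of `A`, which do not vanish by
  nonresonance, so the equation can be solved degree by degree. The solution over an algebraically
  closed field descends along a linear retraction onto the base field, applied coefficientwise.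
-/

namespace FormalNF

open MvPowerSeries

section LinearAlgebra

theorem mem_maxGenEigenspace_of_comp_eq {R M N : Type*} [CommRing R] [AddCommGroup M] [Module R M]
    [AddCommGroup N] [Module R N] {T : Module.End R M} {U : Module.End R N} {e : M →ₗ[R] N}
    (h : U ∘ₗ e = e ∘ₗ T) {c : R} {x : M} (hx : x ∈ T.maxGenEigenspace c) :
    e x ∈ U.maxGenEigenspace c := by
  rw [Module.End.mem_maxGenEigenspace] at hx ⊢
  obtain ⟨k, hk⟩ := hx
  have hc : (U - c • 1) ∘ₗ e = e ∘ₗ (T - c • 1) := by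
    rw [LinearMap.sub_comp, LinearMap.comp_sub, h]
    ext y
    simp
  have hpow := LinearMap.congr_fun (Module.End.commute_pow_left_of_commute hc k) x
  rw [LinearMap.comp_apply, LinearMap.comp_apply, hk, map_zero] at hpow
  exact ⟨k, hpow⟩

theorem iSup_spectrum_maxGenEigenspace_eq_top {K V : Type*} [Field K] [IsAlgClosed K]
    [AddCommGroup V] [Module K V] [FiniteDimensional K V] (T : Module.End K V) :
    ⨆ c ∈ spectrum K T, T.maxGenEigenspace c = ⊤ := by
  rw [eq_top_iff, ← Module.End.iSup_maxGenEigenspace_eq_top T]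
  refine iSup_le fun c => ?_
  by_cases hc : c ∈ spectrum K T
  · exact le_iSup₂_of_le c hc le_rfl
  · rw [← Module.End.hasEigenvalue_iff_mem_spectrum] at hc
    have hbot : T.maxGenEigenspace c = ⊥ := by
      by_contra h
      exact hc (Module.End.HasUnifEigenvalue.lt zero_lt_one h)
    exact hbot.trans_le bot_le

attribute [local instance] LieRing.ofAssociativeRing

variable {K A : Type*} [CommRing K] [CommRing A] [Algebra K A] (D : Derivation K A A)

theorem mul_mem_maxGenEigenspace {a b : K} {x y : A}
    (hx : x ∈ Module.End.maxGenEigenspace D.toLinearMap a)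
    (hy : y ∈ Module.End.maxGenEigenspace D.toLinearMap b) :
    x * y ∈ Module.End.maxGenEigenspace D.toLinearMap (a + b) := by
  -- The Leibniz rule says that `x ↦ (x * ·)` intertwines `D` with the commutator by `D`.
  have hcomm : LieAlgebra.ad K (Module.End K A) D.toLinearMap ∘ₗ LinearMap.mul K A =
      LinearMap.mul K A ∘ₗ D.toLinearMap := by
    ext u v
    simp [LieRing.of_associative_ring_bracket, mul_comm]
  have hx' := mem_maxGenEigenspace_of_comp_eq hcomm hx
  exact LieModule.lie_mem_maxGenEigenspace_toEnd (x := D.toLinearMap)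
    (y := LinearMap.mul K A x) hx' hy

theorem iSup_maxGenEigenspace_mul_self_le (S : AddSubsemigroup K) :
    (⨆ c ∈ S, Module.End.maxGenEigenspace D.toLinearMap c) *
      (⨆ c ∈ S, Module.End.maxGenEigenspace D.toLinearMap c) ≤
      ⨆ c ∈ S, Module.End.maxGenEigenspace D.toLinearMap c := by
  simp only [Submodule.iSup_mul, Submodule.mul_iSup]
  refine iSup₂_le fun a ha => iSup₂_le fun b hb => ?_
  refine le_iSup₂_of_le (b + a) (S.add_mem hb ha) ?_
  exact Submodule.mul_le.2 fun x hx y hy => mul_mem_maxGenEigenspace D hx hy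

theorem pow_le_iSup_maxGenEigenspace {S : AddSubsemigroup K} {V : Submodule K A}
    (hV : V ≤ ⨆ c ∈ S, Module.End.maxGenEigenspace D.toLinearMap c) {k : ℕ} (hk : 1 ≤ k) :
    V ^ k ≤ ⨆ c ∈ S, Module.End.maxGenEigenspace D.toLinearMap c := by
  induction k, hk using Nat.le_induction with
  | base => rwa [pow_one]
  | succ k _ ih =>
    rw [pow_succ]
    exact (mul_le_mul' ih hV).trans (iSup_maxGenEigenspace_mul_self_le D S)

theorem pow_le_comap_pow {V : Submodule K A} (hV : V ≤ V.comap D.toLinearMap) (k : ℕ) :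
    V ^ k ≤ (V ^ k).comap D.toLinearMap := by
  induction k with
  | zero =>
    rw [pow_zero, Submodule.one_eq_span, Submodule.span_le]
    simp
  | succ k ih =>
    rw [pow_succ, Submodule.mul_le]
    intro x hx y hy
    rw [Submodule.mem_comap, Derivation.coeFn_coe, Derivation.leibniz]
    refine add_mem (Submodule.mul_mem_mul hx (hV hy)) ?_
    rw [smul_eq_mul, mul_comm y]
    exact Submodule.mul_mem_mul (ih hx) hy

theorem map_eq_self_of_le_iSup_maxGenEigenspace {K V : Type*} [Field K] [AddCommGroup V]
    [Module K V] {T : Module.End K V} {S : Set K} (hS : 0 ∉ S) {p : Submodule K V}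
    [FiniteDimensional K p] (hp : p ≤ p.comap T) (hpS : p ≤ ⨆ c ∈ S, T.maxGenEigenspace c) :
    p.map T = p := by
  have hker : Disjoint p (LinearMap.ker T) := by
    refine ((T.independent_maxGenEigenspace 0).symm).mono
      (hpS.trans (iSup₂_le fun c hc => le_iSup₂_of_le c (ne_of_mem_of_not_mem hc hS) le_rfl)) ?_
    intro x hx
    exact (Module.End.mem_maxGenEigenspace _ _ _).2 ⟨1, by simpa using hx⟩
  have hinj : Function.Injective (T.restrict hp) :=
    (LinearMap.injective_restrict_iff hp).2 hker
  refine le_antisymm (Submodule.map_le_iff_le_comap.2 hp) fun x hx => ?_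
  obtain ⟨y, hy⟩ := LinearMap.injective_iff_surjective.1 hinj ⟨x, hx⟩
  exact ⟨y, y.2, congrArg Subtype.val hy⟩

theorem card_mul_eq_zero_of_commutator_eq_smul {σ R : Type*} [Fintype σ] [DecidableEq σ]
    [CommRing R] {A B : Matrix σ σ R} (hA : IsUnit A.det) {c : R}
    (h : A * B - B * A = c • A) : (Fintype.card σ : R) * c = 0 := by
  have htr := congrArg (fun M => (A⁻¹ * M).trace) h
  simp only [mul_sub, Matrix.trace_sub, Matrix.mul_smul, Matrix.trace_smul] at htr
  rw [Matrix.nonsing_inv_mul_cancel_left _ _ hA, Matrix.trace_mul_comm A⁻¹ (B * A),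
    Matrix.mul_nonsing_inv_cancel_right _ _ hA, sub_self, Matrix.nonsing_inv_mul _ hA,
    Matrix.trace_one, smul_eq_mul, mul_comm] at htr
  exact htr.symm

theorem det_ne_zero_of_zero_notMem_spectrum_map {σ K L : Type*} [Fintype σ] [DecidableEq σ]
    [Field K] [Field L] [Algebra K L] {A : Matrix σ σ K}
    (hA : 0 ∉ spectrum L (A.map (algebraMap K L))) : A.det ≠ 0 := by
  rw [spectrum.zero_notMem_iff, Matrix.isUnit_iff_isUnit_det, ← RingHom.mapMatrix_apply,
    ← RingHom.map_det] at hA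
  intro hdet
  simp [hdet] at hA

theorem nsmul_mem_addSubsemigroup {M : Type*} [AddMonoid M] (S : AddSubsemigroup M) {x : M}
    (hx : x ∈ S) {k : ℕ} (hk : 1 ≤ k) : k • x ∈ S := by
  induction k, hk using Nat.le_induction with
  | base => rwa [one_nsmul]
  | succ k _ ih => rw [succ_nsmul]; exact S.add_mem ih hx

theorem exists_nsmul_sum_of_mem_closure_range {ι M : Type*} [Fintype ι] [AddCommMonoid M]
    {v : ι → M} {x : M} (hx : x ∈ AddSubsemigroup.closure (Set.range v)) :
    ∃ m : ι → ℕ, 1 ≤ ∑ i, m i ∧ ∑ i, m i • v i = x := by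
  classical
  induction hx using AddSubsemigroup.closure_induction with
  | mem x hx =>
    obtain ⟨i, rfl⟩ := hx
    exact ⟨Pi.single i 1, by simp, by simp [Pi.single_apply, ite_smul]⟩
  | add x y _ _ hx hy =>
    obtain ⟨m, hm, rfl⟩ := hx
    obtain ⟨l, -, rfl⟩ := hy
    refine ⟨m + l, ?_, by simp [add_smul, Finset.sum_add_distrib]⟩
    simp only [Pi.add_apply, Finset.sum_add_distrib]
    omega

end LinearAlgebra

section OrderFiltration

open Finsupp

variable {σ : Type*}

section CommSemiring

variable {R : Type*} [CommSemiring R]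

/-- The filtration of the power series by order: the series without terms of degree less
than `k`. -/
def orderGE (σ R : Type*) [CommSemiring R] (k : ℕ) : Submodule R (MvPowerSeries σ R) where
  carrier := {φ | (k : ℕ∞) ≤ φ.order}
  add_mem' hφ hψ := (le_min hφ hψ).trans min_order_le_add
  zero_mem' := by simp
  smul_mem' _ _ hφ := hφ.trans le_order_smul

theorem mem_orderGE {k : ℕ} {φ : MvPowerSeries σ R} : φ ∈ orderGE σ R k ↔ (k : ℕ∞) ≤ φ.order :=
  Iff.rfl

theorem mem_orderGE_iff_coeff {k : ℕ} {φ : MvPowerSeries σ R} :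
    φ ∈ orderGE σ R k ↔ ∀ d, degree d < k → coeff d φ = 0 :=
  ⟨fun h _ hd => coeff_of_lt_order (lt_of_lt_of_le (mod_cast hd) h), nat_le_order⟩

theorem mem_orderGE_one {φ : MvPowerSeries σ R} : φ ∈ orderGE σ R 1 ↔ constantCoeff φ = 0 := by
  rw [mem_orderGE, Nat.cast_one, one_le_order_iff_constCoeff_eq_zero]

theorem orderGE_anti : Antitone (orderGE σ R) :=
  fun _ _ h _ hφ => mem_orderGE.2 ((Nat.cast_le.2 h).trans hφ)

theorem mul_mem_orderGE {k l : ℕ} {φ ψ : MvPowerSeries σ R} (hφ : φ ∈ orderGE σ R k)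
    (hψ : ψ ∈ orderGE σ R l) : φ * ψ ∈ orderGE σ R (k + l) := by
  rw [mem_orderGE, Nat.cast_add]
  exact (add_le_add hφ hψ).trans le_order_mul

theorem pderiv_mem_orderGE {k : ℕ} (i : σ) {φ : MvPowerSeries σ R}
    (hφ : φ ∈ orderGE σ R (k + 1)) : pderiv R i φ ∈ orderGE σ R k := by
  rw [mem_orderGE_iff_coeff] at hφ ⊢
  intro d hd
  rw [coeff_pderiv, hφ _ (by simpa using hd), zero_mul]

theorem map_mem_orderGE {S : Type*} [CommSemiring S] (g : R →+* S) {k : ℕ}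
    {φ : MvPowerSeries σ R} (hφ : φ ∈ orderGE σ R k) : map g φ ∈ orderGE σ S k :=
  le_trans hφ (le_order_map g)

/-- The linear forms in the variables. Its `k`-th power in the semiring of submodules consists of
the forms of degree `k`. -/
def linearForms (σ R : Type*) [CommSemiring R] : Submodule R (MvPowerSeries σ R) :=
  Submodule.span R (Set.range X)

theorem X_mem_linearForms (i : σ) : (X i : MvPowerSeries σ R) ∈ linearForms σ R :=
  Submodule.subset_span ⟨i, rfl⟩

theorem linearForms_pow_le_orderGE (k : ℕ) : linearForms σ R ^ k ≤ orderGE σ R k := by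
  induction k with
  | zero => exact fun _ _ => by simp [mem_orderGE]
  | succ k ih =>
    rw [pow_succ]
    refine (mul_le_mul' ih (Submodule.span_le.2 ?_)).trans
      (Submodule.mul_le.2 fun _ hφ _ hψ => mul_mem_orderGE hφ hψ)
    exact Set.range_subset_iff.2 fun i => mem_orderGE_one.2 (constantCoeff_X i)

theorem monomial_mem_linearForms_pow (d : σ →₀ ℕ) :
    monomial d (1 : R) ∈ linearForms σ R ^ degree d := by
  induction d using Finsupp.induction_linear with
  | zero =>
    rw [map_zero, pow_zero, monomial_zero_one]
    exact Submodule.one_le.1 le_rfl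
  | add d e hd he =>
    rw [map_add, pow_add, ← one_mul (1 : R), ← monomial_mul_monomial]
    exact Submodule.mul_mem_mul hd he
  | single i m =>
    rw [degree_single, ← X_pow_eq]
    exact Submodule.pow_mem_pow _ (X_mem_linearForms i) m

theorem homogeneousComponent_mem_linearForms_pow [Finite σ] (k : ℕ) (φ : MvPowerSeries σ R) :
    homogeneousComponent k φ ∈ linearForms σ R ^ k := by
  classical
  have := Fintype.ofFinite σ
  have hsum : homogeneousComponent k φ =
      ∑ d ∈ Finset.univ.finsuppAntidiag k, coeff d φ • monomial d (1 : R) := by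
    ext e
    simp only [coeff_homogeneousComponent, map_sum, map_smul, coeff_monomial, smul_eq_mul, mul_ite,
      mul_one, mul_zero, Finset.sum_ite_eq, Finset.mem_finsuppAntidiag, Finset.subset_univ,
      and_true, degree_eq_sum]
  rw [hsum]
  refine Submodule.sum_mem _ fun d hd => Submodule.smul_mem _ _ ?_
  obtain rfl : degree d = k := by
    rw [degree_eq_sum]
    exact (Finset.mem_finsuppAntidiag.1 hd).1
  exact monomial_mem_linearForms_pow d

end CommSemiring

variable {R : Type*} [CommRing R]

theorem sub_homogeneousComponent_mem_orderGE {k : ℕ} {φ : MvPowerSeries σ R}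
    (hφ : φ ∈ orderGE σ R k) : φ - homogeneousComponent k φ ∈ orderGE σ R (k + 1) := by
  rw [mem_orderGE_iff_coeff] at hφ ⊢
  intro d hd
  rw [map_sub, coeff_homogeneousComponent]
  split_ifs with h
  · exact sub_self _
  · rw [hφ d (by omega), sub_zero]

theorem orderGE_le_linearForms_pow_sup [Finite σ] (k : ℕ) :
    orderGE σ R k ≤ linearForms σ R ^ k ⊔ orderGE σ R (k + 1) :=
  fun φ hφ => Submodule.mem_sup.2 ⟨_, homogeneousComponent_mem_linearForms_pow k φ, _,
    sub_homogeneousComponent_mem_orderGE hφ, add_sub_cancel _ _⟩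

theorem eq_zero_of_forall_mem_orderGE {φ : MvPowerSeries σ R} (h : ∀ k, φ ∈ orderGE σ R k) :
    φ = 0 :=
  MvPowerSeries.ext fun d => mem_orderGE_iff_coeff.1 (h (degree d + 1)) d (Nat.lt_succ_self _)

theorem exists_forall_sub_mem_orderGE {s : ℕ → MvPowerSeries σ R}
    (hs : ∀ k, s (k + 1) - s k ∈ orderGE σ R k) : ∃ β, ∀ k, β - s k ∈ orderGE σ R k := by
  let β : MvPowerSeries σ R := fun d => coeff d (s (degree d + 1))
  refine ⟨β, fun k => mem_orderGE_iff_coeff.2 fun d hd => ?_⟩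
  rw [map_sub, sub_eq_zero]
  change coeff d (s (degree d + 1)) = coeff d (s k)
  induction k, Nat.succ_le_of_lt hd using Nat.le_induction with
  | base => rfl
  | succ k hk ih =>
    have hcoeff := mem_orderGE_iff_coeff.1 (hs k) d hk
    rw [map_sub, sub_eq_zero] at hcoeff
    rw [ih hk, hcoeff]

theorem orderGE_le_range_of_le_map_sup {T : Module.End R (MvPowerSeries σ R)}
    (hT : ∀ k, orderGE σ R k ≤ (orderGE σ R k).comap T) {m : ℕ}
    (hstep : ∀ k ≥ m, orderGE σ R k ≤ (orderGE σ R k).map T ⊔ orderGE σ R (k + 1)) :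
    orderGE σ R m ≤ LinearMap.range T := by
  intro φ hφ
  have hcorr (k : ℕ) (ψ : MvPowerSeries σ R) (hψ : ψ ∈ orderGE σ R (m + k)) :
      ∃ b ∈ orderGE σ R (m + k), ψ - T b ∈ orderGE σ R (m + (k + 1)) := by
    obtain ⟨_, ⟨b, hb, rfl⟩, ρ, hρ, hsum⟩ := Submodule.mem_sup.1 (hstep _ le_self_add hψ)
    exact ⟨b, hb, by rwa [← hsum, add_sub_cancel_left]⟩
  choose! b hb hres using hcorr
  let s (k : ℕ) : MvPowerSeries σ R := Nat.rec 0 (fun k γ => γ + b k (φ - T γ)) k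
  have hs_succ (k : ℕ) : s (k + 1) = s k + b k (φ - T (s k)) := rfl
  have hs (k : ℕ) : φ - T (s k) ∈ orderGE σ R (m + k) := by
    induction k with
    | zero => simpa [s] using hφ
    | succ k ih =>
      rw [hs_succ, map_add, ← sub_sub]
      exact hres k _ ih
  obtain ⟨β, hβ⟩ := exists_forall_sub_mem_orderGE (s := s) fun k => by
    rw [hs_succ, add_sub_cancel_left]
    exact orderGE_anti le_add_self (hb k _ (hs k))
  refine ⟨β, (sub_eq_zero.1 (eq_zero_of_forall_mem_orderGE fun k => ?_)).symm⟩
  rw [← sub_sub_sub_cancel_right φ (T β) (T (s k)), ← map_sub]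
  exact sub_mem (orderGE_anti le_add_self (hs k)) (hT k (hβ k))

end OrderFiltration

section LieDerivative

variable {σ : Type*} [Fintype σ]

section CommSemiring

variable {R : Type*} [CommSemiring R]

/-- The derivation `φ ↦ Dφ · f` of the power series along the vector field `f`. -/
noncomputable def lieDerivative (f : σ → MvPowerSeries σ R) :
    Derivation R (MvPowerSeries σ R) (MvPowerSeries σ R) :=
  ∑ j, f j • pderiv R j

theorem lieDerivative_apply (f : σ → MvPowerSeries σ R) (φ : MvPowerSeries σ R) :
    lieDerivative f φ = ∑ j, pderiv R j φ * f j := by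
  rw [lieDerivative, ← Derivation.coeFnAddMonoidHom_apply, map_sum, Finset.sum_apply]
  exact Finset.sum_congr rfl fun j _ => mul_comm _ _

theorem lieDerivative_X (f : σ → MvPowerSeries σ R) (i : σ) : lieDerivative f (X i) = f i := by
  classical
  simp [lieDerivative_apply, pderiv_X, Pi.single_apply]

theorem lieDerivative_mem_orderGE {f : σ → MvPowerSeries σ R} {k l : ℕ}
    (hf : ∀ j, f j ∈ orderGE σ R (l + 1)) {φ : MvPowerSeries σ R} (hφ : φ ∈ orderGE σ R k) :
    lieDerivative f φ ∈ orderGE σ R (k + l) := by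
  rw [lieDerivative_apply]
  refine Submodule.sum_mem _ fun j _ => ?_
  cases k with
  | zero =>
    have hpd : pderiv R j φ ∈ orderGE σ R 0 := mem_orderGE.2 (by simp)
    exact orderGE_anti (by omega) (mul_mem_orderGE hpd (hf j))
  | succ k => exact orderGE_anti (by omega) (mul_mem_orderGE (pderiv_mem_orderGE j hφ) (hf j))

/-- The linear form `∑ i, v i * X i`. -/
noncomputable def linearForm : (σ → R) →ₗ[R] MvPowerSeries σ R :=
  Fintype.linearCombination R X

theorem linearForm_apply (v : σ → R) : linearForm v = ∑ i, v i • (X i : MvPowerSeries σ R) := rfl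

theorem range_linearForm : LinearMap.range (linearForm (σ := σ) (R := R)) = linearForms σ R :=
  Fintype.range_linearCombination R X

theorem linearForm_mem_orderGE_one (v : σ → R) : linearForm v ∈ orderGE σ R 1 := by
  refine linearForms_pow_le_orderGE 1 ?_
  rw [pow_one, ← range_linearForm]
  exact ⟨v, rfl⟩

theorem map_linearForm {S : Type*} [CommSemiring S] (g : R →+* S) (v : σ → R) :
    map g (linearForm v) = linearForm (g ∘ v) := by
  simp [linearForm_apply, smul_eq_C_mul]

/-- The vector field `x ↦ A x`. -/
noncomputable def linearVectorField (A : Matrix σ σ R) (i : σ) : MvPowerSeries σ R :=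
  linearForm (A i)

theorem lieDerivative_linearVectorField_comp_linearForm (A : Matrix σ σ R) :
    (lieDerivative (linearVectorField A)).toLinearMap ∘ₗ
      linearForm = linearForm ∘ₗ A.vecMulLinear := by
  ext1 v
  simp [linearForm_apply v, lieDerivative_X, linearVectorField, Matrix.vecMul_eq_sum]

theorem linearForms_le_comap_lieDerivative (A : Matrix σ σ R) :
    linearForms σ R ≤
      (linearForms σ R).comap (lieDerivative (linearVectorField A)).toLinearMap := by
  rw [← Submodule.map_le_iff_le_comap, ← range_linearForm, ← LinearMap.range_comp,
    lieDerivative_linearVectorField_comp_linearForm]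
  exact LinearMap.range_comp_le_range _ _

end CommSemiring

section CommRing

variable {R : Type*} [CommRing R]

theorem lieDerivative_sub (f g : σ → MvPowerSeries σ R) (φ : MvPowerSeries σ R) :
    lieDerivative (f - g) φ = lieDerivative f φ - lieDerivative g φ := by
  simp only [lieDerivative_apply, Pi.sub_apply, mul_sub, Finset.sum_sub_distrib]

theorem constantCoeff_pderiv_linearForm (v : σ → R) (j : σ) :
    constantCoeff (pderiv R j (linearForm v)) = v j := by
  classical
  simp [linearForm_apply, pderiv_X, Pi.single_apply]

theorem sub_linearForm_mem_orderGE_two {φ : MvPowerSeries σ R} (hφ : constantCoeff φ = 0) :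
    φ - linearForm (fun j => constantCoeff (pderiv R j φ)) ∈ orderGE σ R 2 := by
  obtain ⟨_, hv, ψ, hψ, rfl⟩ := Submodule.mem_sup.1
    (orderGE_le_linearForms_pow_sup 1 (mem_orderGE_one.2 hφ))
  rw [pow_one, ← range_linearForm] at hv
  obtain ⟨v, rfl⟩ := hv
  have hψ' (j : σ) : constantCoeff (pderiv R j ψ) = 0 :=
    mem_orderGE_one.1 (pderiv_mem_orderGE j hψ)
  simpa [constantCoeff_pderiv_linearForm, hψ'] using hψ

end CommRing

section Surjectivity

variable {L : Type*} [Field L] [DecidableEq σ]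

theorem spectrum_vecMulLinear (A : Matrix σ σ L) :
    spectrum L (A.vecMulLinear : Module.End L (σ → L)) = spectrum L A := by
  have h : (A.vecMulLinear : Module.End L (σ → L)) = Matrix.toLin' A.transpose := by
    ext; simp
  ext c
  rw [h, Matrix.spectrum_toLin', Matrix.mem_spectrum_iff_isRoot_charpoly,
    Matrix.mem_spectrum_iff_isRoot_charpoly, Matrix.charpoly_transpose]

variable [IsAlgClosed L]

theorem linearForms_le_iSup_maxGenEigenspace (A : Matrix σ σ L) :
    linearForms σ L ≤ ⨆ c ∈ spectrum L A, Module.End.maxGenEigenspace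
      (lieDerivative (linearVectorField A)).toLinearMap c := by
  rw [← range_linearForm, LinearMap.range_eq_map,
    ← iSup_spectrum_maxGenEigenspace_eq_top A.vecMulLinear, spectrum_vecMulLinear]
  simp only [Submodule.map_iSup]
  refine iSup₂_mono fun c _ => ?_
  rintro _ ⟨v, hv, rfl⟩
  exact mem_maxGenEigenspace_of_comp_eq (lieDerivative_linearVectorField_comp_linearForm A) hv

theorem map_lieDerivative_linearForms_pow {A : Matrix σ σ L}
    (hA : 0 ∉ AddSubsemigroup.closure (spectrum L A)) {k : ℕ} (hk : 1 ≤ k) :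
    (linearForms σ L ^ k).map (lieDerivative (linearVectorField A)).toLinearMap =
      linearForms σ L ^ k := by
  have hfin : FiniteDimensional L ↥(linearForms σ L ^ k) :=
    Module.Finite.iff_fg.2 ((Submodule.fg_span (Set.finite_range _)).pow k)
  have hspan := (linearForms_le_iSup_maxGenEigenspace A).trans
    (biSup_mono fun c hc => AddSubsemigroup.subset_closure hc)
  exact map_eq_self_of_le_iSup_maxGenEigenspace hA
    (pow_le_comap_pow _ (linearForms_le_comap_lieDerivative A) k)
    (pow_le_iSup_maxGenEigenspace _ hspan hk)

theorem orderGE_le_map_lieDerivative_sup {f : σ → MvPowerSeries σ L} {A : Matrix σ σ L}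
    (hfA : ∀ i, f i - linearForm (A i) ∈ orderGE σ L 2)
    (hA : 0 ∉ AddSubsemigroup.closure (spectrum L A)) {k : ℕ} (hk : 1 ≤ k) :
    orderGE σ L k ≤
      (orderGE σ L k).map (lieDerivative f).toLinearMap ⊔ orderGE σ L (k + 1) := by
  refine (orderGE_le_linearForms_pow_sup k).trans (sup_le ?_ le_sup_right)
  rw [← map_lieDerivative_linearForms_pow hA hk]
  rintro _ ⟨φ, hφ, rfl⟩
  have hφk := linearForms_pow_le_orderGE k hφ
  have hdiff : lieDerivative (f - linearVectorField A) φ ∈ orderGE σ L (k + 1) :=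
    lieDerivative_mem_orderGE hfA hφk
  rw [lieDerivative_sub] at hdiff
  exact Submodule.mem_sup.2 ⟨lieDerivative f φ, ⟨φ, hφk, rfl⟩, _, neg_mem hdiff, by simp⟩

theorem exists_lieDerivative_eq {f : σ → MvPowerSeries σ L} {A : Matrix σ σ L}
    (hfA : ∀ i, f i - linearForm (A i) ∈ orderGE σ L 2)
    (hA : 0 ∉ AddSubsemigroup.closure (spectrum L A)) {α : MvPowerSeries σ L}
    (hα : constantCoeff α = 0) : ∃ β, lieDerivative f β = α := by
  have hf (i : σ) : f i ∈ orderGE σ L (0 + 1) := by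
    rw [← sub_add_cancel (f i) (linearForm (A i))]
    exact add_mem (orderGE_anti one_le_two (hfA i)) (linearForm_mem_orderGE_one _)
  exact orderGE_le_range_of_le_map_sup (T := (lieDerivative f).toLinearMap)
    (fun k _ hφ => lieDerivative_mem_orderGE hf hφ)
    (fun _ hk => orderGE_le_map_lieDerivative_sup hfA hA hk) (mem_orderGE_one.2 hα)

theorem natCast_ne_zero_of_zero_notMem_closure_spectrum [Nonempty σ] {A : Matrix σ σ L}
    (hA : 0 ∉ AddSubsemigroup.closure (spectrum L A)) {k : ℕ} (hk : 1 ≤ k) : (k : L) ≠ 0 := by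
  intro hk0
  obtain ⟨c, hc⟩ := spectrum.nonempty_of_isAlgClosed_of_finiteDimensional L A
  have hmem := nsmul_mem_addSubsemigroup _ (AddSubsemigroup.subset_closure hc) hk
  rw [nsmul_eq_mul, hk0, zero_mul] at hmem
  exact hA hmem

end Surjectivity

end LieDerivative

section Descent

variable {σ R S : Type*} [CommSemiring R] [CommSemiring S] [Algebra R S]

/-- The application of a linear functional to every coefficient of a power series. -/
def coeffwise (r : S →ₗ[R] R) : MvPowerSeries σ S →ₗ[R] MvPowerSeries σ R where
  toFun φ d := r (coeff d φ)
  map_add' φ ψ := by ext d; exact map_add r _ _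
  map_smul' c φ := by ext d; exact map_smul r _ _

theorem coeff_coeffwise (r : S →ₗ[R] R) (φ : MvPowerSeries σ S) (d : σ →₀ ℕ) :
    coeff d (coeffwise r φ) = r (coeff d φ) := rfl

theorem apply_mul_algebraMap (r : S →ₗ[R] R) (s : S) (a : R) :
    r (s * algebraMap R S a) = r s * a := by
  rw [mul_comm, ← Algebra.smul_def, map_smul, smul_eq_mul, mul_comm]

theorem coeffwise_mul_map (r : S →ₗ[R] R) (φ : MvPowerSeries σ S) (ψ : MvPowerSeries σ R) :
    coeffwise r (φ * map (algebraMap R S) ψ) = coeffwise r φ * ψ := by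
  classical
  ext d
  simp only [coeff_coeffwise, coeff_mul, map_sum, coeff_map, apply_mul_algebraMap]

theorem coeffwise_pderiv (r : S →ₗ[R] R) (i : σ) (φ : MvPowerSeries σ S) :
    coeffwise r (pderiv S i φ) = pderiv R i (coeffwise r φ) := by
  ext d
  have h := apply_mul_algebraMap r (coeff (d + Finsupp.single i 1) φ) (d i + 1)
  rwa [map_add, map_natCast, map_one] at h

theorem coeffwise_map {r : S →ₗ[R] R} (hr : r ∘ₗ Algebra.linearMap R S = LinearMap.id)
    (φ : MvPowerSeries σ R) : coeffwise r (map (algebraMap R S) φ) = φ := by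
  ext d
  exact LinearMap.congr_fun hr (coeff d φ)

theorem coeffwise_lieDerivative_map [Fintype σ] (r : S →ₗ[R] R) (f : σ → MvPowerSeries σ R)
    (φ : MvPowerSeries σ S) :
    coeffwise r (lieDerivative (fun i => map (algebraMap R S) (f i)) φ) =
      lieDerivative f (coeffwise r φ) := by
  simp only [lieDerivative_apply, map_sum, coeffwise_mul_map, coeffwise_pderiv]

end Descent

section LieBracket

variable {K : Type*} [Field K] {n : ℕ}

theorem lieBracket_apply (u v : FVectorField K n) (i : Fin n) :
    lieBracket u v i = lieDerivative u (v i) - lieDerivative v (u i) := by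
  rw [lieBracket, lieDerivative_apply, lieDerivative_apply]

theorem lieBracket_sub_smul (f g : FVectorField K n) (β : FSeries K n) :
    lieBracket (g - β • f) f = lieBracket g f + lieDerivative f β • f := by
  ext1 i
  have hsmul : lieDerivative (β • f) (f i) = β * lieDerivative f (f i) := by
    simp only [lieDerivative_apply, Finset.mul_sum, Pi.smul_apply, smul_eq_mul, mul_left_comm]
  simp only [Pi.add_apply, Pi.smul_apply, lieBracket_apply, lieDerivative_sub, hsmul, Pi.sub_apply,
    map_sub, smul_eq_mul, Derivation.leibniz]
  ring

theorem constantCoeff_lieBracket {f : FVectorField K n} (hf0 : ∀ i, constantCoeff (f i) = 0)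
    (g : FVectorField K n) (i : Fin n) : constantCoeff (lieBracket g f i) =
      (jacobianAtZero f).mulVec (fun j => constantCoeff (g j)) i := by
  simp [lieBracket, hf0, Matrix.mulVec, dotProduct, jacobianAtZero]

theorem jacobianAtZero_lieBracket {f g : FVectorField K n} (hf0 : ∀ i, constantCoeff (f i) = 0)
    (hg0 : ∀ i, constantCoeff (g i) = 0) : jacobianAtZero (lieBracket g f) =
      jacobianAtZero f * jacobianAtZero g - jacobianAtZero g * jacobianAtZero f := by
  ext i k
  simp [lieBracket, hf0, hg0, Matrix.mul_apply, jacobianAtZero]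

theorem jacobianAtZero_smul {f : FVectorField K n} (hf0 : ∀ i, constantCoeff (f i) = 0)
    (α : FSeries K n) : jacobianAtZero (α • f) = constantCoeff α • jacobianAtZero f := by
  ext i k
  simp [hf0, jacobianAtZero]

theorem natCast_mul_constantCoeff_eq_zero {f g : FVectorField K n} {α : FSeries K n}
    (hf0 : ∀ i, constantCoeff (f i) = 0) (hdet : (jacobianAtZero f).det ≠ 0)
    (hg : lieBracket g f = α • f) : (n : K) * constantCoeff α = 0 := by
  have hmul : (jacobianAtZero f).mulVec (fun j => constantCoeff (g j)) = 0 := by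
    ext i
    rw [← constantCoeff_lieBracket hf0, hg]
    simp [hf0]
  have hg0 : ∀ i, constantCoeff (g i) = 0 :=
    congrFun (Matrix.eq_zero_of_mulVec_eq_zero hdet hmul)
  have hcomm := jacobianAtZero_lieBracket hf0 hg0
  rw [hg, jacobianAtZero_smul hf0] at hcomm
  simpa using card_mul_eq_zero_of_commutator_eq_smul (isUnit_iff_ne_zero.2 hdet) hcomm.symm

section Spectrum

variable {L : Type*} [Field L] [IsAlgClosed L] [Algebra K L] {f : FVectorField K n}
  {α : FSeries K n}

theorem constantCoeff_eq_zero_of_lieBracket_eq_smul (hn : 0 < n)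
    (hf0 : ∀ i, constantCoeff (f i) = 0)
    (hA : 0 ∉ AddSubsemigroup.closure (spectrum L ((jacobianAtZero f).map (algebraMap K L))))
    {g : FVectorField K n} (hg : lieBracket g f = α • f) : constantCoeff α = 0 := by
  have : Nonempty (Fin n) := ⟨⟨0, hn⟩⟩
  have hdet : (jacobianAtZero f).det ≠ 0 :=
    det_ne_zero_of_zero_notMem_spectrum_map fun h => hA (AddSubsemigroup.subset_closure h)
  have hnK : (n : K) ≠ 0 := by
    have hnL := natCast_ne_zero_of_zero_notMem_closure_spectrum hA hn
    rw [← map_natCast (algebraMap K L)] at hnL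
    exact (map_ne_zero _).1 hnL
  exact (mul_eq_zero.1 (natCast_mul_constantCoeff_eq_zero hf0 hdet hg)).resolve_left hnK

theorem exists_lieDerivative_eq_of_spectrum_map (hf0 : ∀ i, constantCoeff (f i) = 0)
    (hA : 0 ∉ AddSubsemigroup.closure (spectrum L ((jacobianAtZero f).map (algebraMap K L))))
    (hα : constantCoeff α = 0) : ∃ β, lieDerivative f β = α := by
  obtain ⟨r, hr⟩ := (Algebra.linearMap K L).exists_leftInverse_of_injective
    (LinearMap.ker_eq_bot.2 (algebraMap K L).injective)
  have hfA (i : Fin n) : map (algebraMap K L) (f i) -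
      linearForm ((jacobianAtZero f).map (algebraMap K L) i) ∈ orderGE (Fin n) L 2 := by
    have hi := map_mem_orderGE (algebraMap K L) (sub_linearForm_mem_orderGE_two (hf0 i))
    rwa [map_sub, map_linearForm] at hi
  obtain ⟨β, hβ⟩ := exists_lieDerivative_eq (α := map (algebraMap K L) α) hfA hA (by simp [hα])
  refine ⟨coeffwise r β, ?_⟩
  rw [← coeffwise_lieDerivative_map, hβ, coeffwise_map hr]

end Spectrum

end LieBracket

section Nonresonance

theorem IsEigenvalueList.spectrum_eq {𝕂 : Type*} [RCLike 𝕂] {n : ℕ}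
    {A : Matrix (Fin n) (Fin n) 𝕂} {lam : Fin n → ℂ} (hlam : IsEigenvalueList A lam) :
    spectrum ℂ (A.map (toComplexHom 𝕂)) = Set.range lam := by
  ext c
  rw [Matrix.mem_spectrum_iff_isRoot_charpoly,
    ← Polynomial.mem_roots (Matrix.charpoly_monic _).ne_zero, hlam]
  simp

theorem NonResonant.zero_notMem_closure_range {n : ℕ} {lam : Fin n → ℂ} (hres : NonResonant lam) :
    0 ∉ AddSubsemigroup.closure (Set.range lam) := by
  intro h0
  obtain ⟨m, hm, hsum⟩ := exists_nsmul_sum_of_mem_closure_range h0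
  obtain ⟨j, -, -⟩ := Finset.exists_ne_zero_of_sum_ne_zero (Nat.one_le_iff_ne_zero.1 hm)
  have hdeg : 2 ≤ ∑ i, (m + Pi.single j 1 : Fin n → ℕ) i := by
    simp only [Pi.add_apply, Finset.sum_add_distrib, Finset.sum_pi_single', Finset.mem_univ,
      if_true]
    omega
  -- A vanishing sum of eigenvalues yields a resonance after adding `λⱼ` to both sides.
  refine hres (m + Pi.single j 1) j hdeg ?_
  simpa [add_mul, Finset.sum_add_distrib, Pi.single_apply] using hsum

end Nonresonance

end FormalNF

theorem proposition4p18_general {K L : Type*} [Field K] [Field L] [IsAlgClosed L] [Algebra K L]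
    {n : ℕ} (f : FormalNF.FVectorField K n)
    (hf0 : ∀ i, MvPowerSeries.constantCoeff (f i) = 0)
    (hA : 0 ∉ AddSubsemigroup.closure
      (spectrum L ((FormalNF.jacobianAtZero f).map (algebraMap K L))))
    (g : FormalNF.FVectorField K n) (α : FormalNF.FSeries K n)
    (hg : FormalNF.lieBracket g f = α • f) :
    ∃ (h : FormalNF.FVectorField K n) (β : FormalNF.FSeries K n),
      g = h + β • f ∧ FormalNF.lieBracket h f = 0 := by
  rcases Nat.eq_zero_or_pos n with rfl | hn
  · exact ⟨g, 0, Subsingleton.elim _ _, Subsingleton.elim _ _⟩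
  have hα := FormalNF.constantCoeff_eq_zero_of_lieBracket_eq_smul hn hf0 hA hg
  obtain ⟨β, hβ⟩ := FormalNF.exists_lieDerivative_eq_of_spectrum_map (α := -α) hf0 hA
    (by rw [map_neg, hα, neg_zero])
  refine ⟨g - β • f, β, (sub_add_cancel g _).symm, ?_⟩
  rw [FormalNF.lieBracket_sub_smul, hg, hβ, neg_smul, add_neg_cancel]

theorem proposition4p18 {𝕂 : Type*} [RCLike 𝕂] {n : ℕ}
    (f : FormalNF.FVectorField 𝕂 n)
    (hf0 : ∀ i, MvPowerSeries.constantCoeff (f i) = 0)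
    (lam : Fin n → ℂ)
    (hlam : FormalNF.IsEigenvalueList (FormalNF.jacobianAtZero f) lam)
    (hres : FormalNF.NonResonant lam)
    (g : FormalNF.FVectorField 𝕂 n) (α : FormalNF.FSeries 𝕂 n)
    (hg : FormalNF.lieBracket g f = α • f) :
    ∃ (h : FormalNF.FVectorField 𝕂 n) (β : FormalNF.FSeries 𝕂 n),
      g = h + β • f ∧ FormalNF.lieBracket h f = 0 := by
  let : Algebra 𝕂 ℂ := (FormalNF.toComplexHom 𝕂).toAlgebra
  exact proposition4p18_general (L := ℂ) f hf0
    (hlam.spectrum_eq ▸ hres.zero_notMem_closure_range) g α hg
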